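/- Let $n\ge 2$ and let $L,\lambda,R,v_{\max},v^*,\mu$ be real constants with $\mu>0$, $0<v^*<v_{\max}$, $0<L<R/n$ and $\lambda>L$. Let $V\in C^3((L,\infty);[0,\infty))$ satisfy $\lim_{x\to L^+}V(x)=+\infty$, $V(x)=0$ for $x\ge\lambda$, and $V'(x)<0$, $V''(x)>0$ for $x\in(L,\lambda)$. Let $b:\mathbb R\to(v^*-v_{\max},v^*)$ be a $C^2$ strictly increasing function with $b(0)=0$, $x\,b(x)>0$ for $x\ne0$, and $b'(0)>0$. For $(s,v)=(s_2,\dots,s_n,v_1,\dots,v_n)\in\mathbb R^{2n-1}$ put $s_{n+1}=s_1=R-\sum_{i=2}^n s_i$, $v_0=v_n$, $v_{n+1}=v_1$, and let $$\Omega=\{(s,v)\in\mathbb R^{2n-1}: s_i>L,\ 0<v_i<v_{\max},\ i=1,\dots,n\},$$ $$E=\{(s,v)\in\mathbb R^{2n-1}: s_i\ge\lambda,\ v_i=v^*,\ i=1,\dots,n\}.$$ For $(s,v)\in\Omega$ and $i=1,\dots,n$ define $$f_i(s)=v^*-b\big(V'(s_{i+1})-V'(s_i)\big),\qquad H(s,v)=\frac{v_{\max}^2}{2}\sum_{i=1}^n\frac{(v_i-f_i(s))^2}{v_i(v_{\max}-v_i)}+\sum_{i=1}^nV(s_i),$$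 $$\beta(w,y)=\frac{v_{\max}^3(w+y)-2v_{\max}^2yw}{2(v_{\max}-w)^2w^2}\quad (w,y\in(0,v_{\max})),$$ $$Z_i(s,v)=-v_{\max}^2\,b'\big(V'(s_{i+1})-V'(s_i)\big)\big(V''(s_{i+1})(v_i-v_{i+1})-V''(s_i)(v_{i-1}-v_i)\big),$$ $$F_i(s,v)=\frac1{\beta(v_i,f_i(s))}\left(\frac{Z_i(s,v)-\mu v_{\max}^2(v_i-f_i(s))}{v_i(v_{\max}-v_i)}+V'(s_i)-V'(s_{i+1})\right),$$ and consider the closed-loop system on the open set $\Omega$ $$\dot s_i=v_{i-1}-v_i\ (i=2,\dots,n),\qquad \dot v_i=F_i(s,v)\ (i=1,\dots,n).$$ Suppose that $R\ge n\lambda$. Then there exist functions $\sigma\in KL$ and $a\in K_\infty$ (depending only on the data above, not on the solution) such that: for every initial state in $\Omega$ there is a solution in $\Omega$ defined for all $t\ge0$; every solution in $\Omega$ on an interval $[0,T)$, $0<T\le\infty$, extends to a solution defined for all $t\ge0$ with values in $\Omega$; and every solution satisfies, for all $t\ge 0$, $$a\big(\operatorname{dist}((s(t),v(t)),E)\big)\le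 H(s(t),v(t))\le\sigma\big(H(s(0),v(0)),t\big),$$ where $\operatorname{dist}$ is the Euclidean distance in $\mathbb R^{2n-1}$. Here $K_\infty$ is the class of continuous strictly increasing $a:[0,\infty)\to[0,\infty)$ with $a(0)=0$ and $a(r)\to\infty$ as $r\to\infty$, and $KL$ is the class of continuous $\sigma:[0,\infty)^2\to[0,\infty)$ such that for each $t\ge0$ the map $\sigma(\cdot,t)$ is continuous and strictly increasing with $\sigma(0,t)=0$, and for each $r\ge0$ the map $\sigma(r,\cdot)$ is non-increasing with limit $0$ at infinity. -/

import Mathlib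

noncomputable section

namespace RingRoad

/-- A continuous strictly increasing function on `[0, ∞)` vanishing at `0`
(values at negative arguments are irrelevant). -/
structure ClassK (a : ℝ → ℝ) : Prop where
  continuousOn : ContinuousOn a (Set.Ici 0)
  strictMonoOn : StrictMonoOn a (Set.Ici 0)
  map_zero : a 0 = 0

/-- An unbounded function of class `K`. -/
structure ClassKInf (a : ℝ → ℝ) : Prop extends ClassK a where
  tendsto_atTop : Filter.Tendsto a Filter.atTop Filter.atTop

/-- Class `KL`: jointly continuous on `[0, ∞) × [0, ∞)`, of class `K` in the first variable,
non-increasing with limit `0` in the second one. -/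
structure ClassKL (σ : ℝ → ℝ → ℝ) : Prop where
  continuousOn : ContinuousOn (fun p : ℝ × ℝ => σ p.1 p.2) (Set.Ici 0 ×ˢ Set.Ici 0)
  classK : ∀ t, 0 ≤ t → ClassK (fun r => σ r t)
  antitoneOn : ∀ r, 0 ≤ r → AntitoneOn (σ r) (Set.Ici 0)
  tendsto_zero : ∀ r, 0 ≤ r → Filter.Tendsto (σ r) Filter.atTop (nhds 0)

/-- The state space `ℝ^(2n-1)` with its Euclidean norm. Vehicles are indexed by `Fin n`, the first
vehicle having index `0`; the coordinates are the spacings `s_i` of all vehicles but the first one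
and the speeds `v_i` of all vehicles. -/
abbrev State (n : ℕ) [NeZero n] : Type :=
  EuclideanSpace ℝ ({i : Fin n // i ≠ 0} ⊕ Fin n)

/-- The data of the ring-road and of the cruise controller: safety distance `L`, interaction
distance `lam`, length `R` of the road, speed limit `vmax`, desired speed `vstar`, gain `μ`,
potential `V` and the function `b`. -/
structure Params where
  L : ℝ
  lam : ℝ
  R : ℝ
  vmax : ℝ
  vstar : ℝ
  μ : ℝ
  V : ℝ → ℝ
  b : ℝ → ℝ

variable {n : ℕ} [NeZero n] (P : Params)

/-- The spacing of vehicle `i`; for the first vehicle it is `R` minus the sum of all others. -/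
def spacing (x : State n) (i : Fin n) : ℝ :=
  if h : i = 0 then P.R - ∑ j : {i : Fin n // i ≠ 0}, x (Sum.inl j) else x (Sum.inl ⟨i, h⟩)

/-- The speed of vehicle `i`. -/
def speed (x : State n) (i : Fin n) : ℝ := x (Sum.inr i)

/-- The open state space: all spacings exceed `L` and all speeds lie in `(0, vmax)`. -/
def Omega (n : ℕ) [NeZero n] : Set (State n) :=
  {x | (∀ i, P.L < spacing P x i) ∧ ∀ i, 0 < speed x i ∧ speed x i < P.vmax}

/-- The set of equilibria: all spacings are at least `lam` and all speeds equal `vstar`. -/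
def E (n : ℕ) [NeZero n] : Set (State n) :=
  {x | (∀ i, P.lam ≤ spacing P x i) ∧ ∀ i, speed x i = P.vstar}

/-! Addition and subtraction in `Fin n` are cyclic, so `i + 1` is the vehicle following `i`
and `i - 1` is the vehicle preceding `i` on the ring. -/

/-- The spacing-dependent desired speed `f_i(s)`. -/
def f (x : State n) (i : Fin n) : ℝ :=
  P.vstar - P.b (deriv P.V (spacing P x (i + 1)) - deriv P.V (spacing P x i))

/-- The Lyapunov function `H(s, v)`. -/
def H (x : State n) : ℝ :=
  P.vmax ^ 2 / 2 * ∑ i, (speed x i - f P x i) ^ 2 / (speed x i * (P.vmax - speed x i))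
    + ∑ i, P.V (spacing P x i)

/-- The function `β(v, y)`. -/
def beta (v y : ℝ) : ℝ :=
  (P.vmax ^ 3 * (v + y) - 2 * P.vmax ^ 2 * y * v) / (2 * (P.vmax - v) ^ 2 * v ^ 2)

/-- The viscosity term `Z_i(s, v)`. -/
def Z (x : State n) (i : Fin n) : ℝ :=
  -P.vmax ^ 2 * deriv P.b (deriv P.V (spacing P x (i + 1)) - deriv P.V (spacing P x i)) *
    (deriv (deriv P.V) (spacing P x (i + 1)) * (speed x i - speed x (i + 1))
      - deriv (deriv P.V) (spacing P x i) * (speed x (i - 1) - speed x i))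

/-- The cruise controller: the acceleration `F_i` of vehicle `i`. -/
def accel (x : State n) (i : Fin n) : ℝ :=
  1 / beta P (speed x i) (f P x i) *
    ((Z P x i - P.μ * P.vmax ^ 2 * (speed x i - f P x i)) / (speed x i * (P.vmax - speed x i))
      + deriv P.V (spacing P x i) - deriv P.V (spacing P x (i + 1)))

/-- The right-hand side of the closed-loop system. -/
def closedLoop (x : State n) : State n :=
  WithLp.toLp 2 (Sum.elim
    (fun i : {i : Fin n // i ≠ 0} => speed x (i.1 - 1) - speed x i.1)
    (fun i : Fin n => accel P x i))

/-- `x` is a solution of the closed-loop system with values in `Omega` on the interval `[0, T)`,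
where `0 < T ≤ ∞` (at `t = 0` the derivative is the right derivative; the values of `x` outside
`[0, T)` are irrelevant). -/
structure IsSolution (T : EReal) (x : ℝ → State n) : Prop where
  pos : 0 < T
  mem : ∀ t : ℝ, 0 ≤ t → (t : EReal) < T → x t ∈ Omega P n
  hasDeriv : ∀ t : ℝ, 0 ≤ t → (t : EReal) < T →
    HasDerivWithinAt x (closedLoop P (x t)) (Set.Ici 0) t

/-- The standing assumptions on the constants. -/
structure AdmissibleConstants (P : Params) (n : ℕ) : Prop where
  two_le : 2 ≤ n
  L_pos : 0 < P.L
  L_lt_R : n * P.L < P.R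
  L_lt_lam : P.L < P.lam
  vstar_pos : 0 < P.vstar
  vstar_lt : P.vstar < P.vmax
  μ_pos : 0 < P.μ

/-- The standing assumptions on the potential `V`, a function on `(L, ∞)`. -/
structure AdmissiblePotential (P : Params) : Prop where
  contDiffOn : ContDiffOn ℝ 3 P.V (Set.Ioi P.L)
  nonneg : ∀ x, P.L < x → 0 ≤ P.V x
  tendsto : Filter.Tendsto P.V (nhdsWithin P.L (Set.Ioi P.L)) Filter.atTop
  eq_zero : ∀ x, P.lam ≤ x → P.V x = 0
  deriv_neg : ∀ x ∈ Set.Ioo P.L P.lam, deriv P.V x < 0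
  deriv2_pos : ∀ x ∈ Set.Ioo P.L P.lam, 0 < deriv (deriv P.V) x

/-- The standing assumptions on the function `b`. -/
structure AdmissibleB (P : Params) : Prop where
  contDiff : ContDiff ℝ 2 P.b
  strictMono : StrictMono P.b
  mem : ∀ x, P.b x ∈ Set.Ioo (P.vstar - P.vmax) P.vstar
  map_zero : P.b 0 = 0
  mul_pos : ∀ x, x ≠ 0 → 0 < x * P.b x
  deriv_zero_pos : 0 < deriv P.b 0

end RingRoad

end

/-! ### Global flows of `C¹` vector fields with a Lyapunov function. -/

noncomputable section
open Set Filter Topology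
open scoped Manifold

/-! `H` is a strict Lyapunov function for `E`. The factor `β` is chosen so that (v - y) β(v, y) is
the v-derivative of (vmax²/2)(v - y)²/(v(vmax - v)), and `Z` is vmax² times the derivative of `f`
along the flow. With these, H' = -W, where W is the sum of a weighted square of v - f and of the
terms gap · b(gap) ≥ 0; the potential terms cancel after cyclic summation (`fderiv_H_closedLoop`).

Sublevel sets of `H` are compact in `Omega` (`isCompact_sublevel`): V blows up at L, which keeps the
spacings off L and hence `f` off 0 and vmax; the quotients in `H` then keep the speeds off 0 and
vmax. This gives global existence and uniqueness.

`H` and W vanish exactly on `E`. If W = 0, all V'(s_i) agree; one spacing below λ would force all of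
them below λ, contradicting R ≥ nλ (`mem_E_of_dissipation_eq_zero`).

By compactness W ≥ ρ(H) with ρ continuous and positive definite, so H' ≤ -ρ(H), and comparison with
the scalar equation gives the `KL` bound. The bound by the distance to `E` comes from the same kind
of penalised infimum. -/

/-- A `C¹` vector field with compact support has global integral curves. -/
theorem ContDiff.exists_global_integralCurve {E : Type*} [NormedAddCommGroup E] [NormedSpace ℝ E]
    [CompleteSpace E] {F : E → E} (hF : ContDiff ℝ 1 F) (hc : HasCompactSupport F) (x₀ : E) :
    ∃ x : ℝ → E, x 0 = x₀ ∧ ∀ t, HasDerivAt x (F (x t)) t := by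
  obtain ⟨C, hC⟩ := ContDiff.lipschitzWith_of_hasCompactSupport hc hF one_ne_zero
  obtain ⟨B, hB⟩ := hc.exists_bound_of_continuous hF.continuous
  have hB0 : 0 ≤ B := (norm_nonneg _).trans (hB x₀)
  have hloc : ∀ x : E, ∃ γ : ℝ → E, γ 0 = x ∧
      IsMIntegralCurveOn (I := 𝓘(ℝ, E)) γ F (Ioo (-1) 1) := by
    intro x
    -- As the field is bounded by `B`, a ball of radius `B` is not left within time 1, so the
    -- existence time is the same for all starting points and local curves can be glued.
    have hPL : IsPicardLindelof (fun _ : ℝ => F) (tmin := -1) (tmax := 1)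
        ⟨0, by simp⟩ x ⟨B, hB0⟩ 0 ⟨B, hB0⟩ C :=
      IsPicardLindelof.of_time_independent (fun y _ => hB y) hC.lipschitzOnWith (by simp)
    obtain ⟨α, h0, hα⟩ := hPL.exists_eq_forall_mem_Icc_hasDerivWithinAt₀
    refine ⟨α, h0, fun t ht => ?_⟩
    have hd := ((hα t (Ioo_subset_Icc_self ht)).mono Ioo_subset_Icc_self).hasFDerivWithinAt
    exact hasMFDerivWithinAt_iff_hasFDerivWithinAt.2 hd
  obtain ⟨γ, h0, hγ⟩ := exists_isMIntegralCurve_of_isMIntegralCurveOn (I := 𝓘(ℝ, E)) (v := F)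
    (contMDiff_vectorSpace_iff_contDiff.2 hF) one_pos hloc x₀
  refine ⟨γ, h0, fun t => ?_⟩
  have hd := hasMFDerivAt_iff_hasFDerivAt.1 (hγ t)
  exact hasDerivAt_iff_hasFDerivAt.2 hd

/-- A vector field that is `C¹` on an open set agrees on a given compact subset with a compactly
supported `C¹` vector field which is a multiple of it by a nonnegative function. -/
theorem ContDiffOn.exists_cutoff {E : Type*} [NormedAddCommGroup E] [NormedSpace ℝ E]
    [FiniteDimensional ℝ E] {F : E → E} {U K : Set E} (hU : IsOpen U) (hF : ContDiffOn ℝ 1 F U)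
    (hK : IsCompact K) (hKU : K ⊆ U) :
    ∃ χ : E → ℝ, (∀ x, 0 ≤ χ x) ∧ (∀ x ∈ K, χ x = 1) ∧ ContDiff ℝ 1 (fun x => χ x • F x) ∧
      HasCompactSupport (fun x => χ x • F x) := by
  obtain ⟨O, hO, hKO, hOU, hOc⟩ := exists_open_between_and_isCompact_closure hK hU hKU
  obtain ⟨χ, hχ, hr, hs, h1⟩ := exists_contMDiff_support_eq_eq_one_iff (n := 1) 𝓘(ℝ, E) hO
    hK.isClosed hKO
  have hcs : HasCompactSupport χ := by rw [HasCompactSupport, tsupport, hs]; exact hOc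
  refine ⟨χ, fun x => (hr ⟨x, rfl⟩).1, fun x hx => (h1 x).1 hx, ?_, hcs.smul_right⟩
  rw [contDiff_iff_contDiffAt]
  intro x
  by_cases hx : x ∈ U
  -- Nothing is known about `F` off `U`, but the support of χ is closed and contained in `U`, so the
  -- product vanishes near points outside `U`.
  · exact hχ.contDiff.contDiffAt.smul (hF.contDiffAt (hU.mem_nhds hx))
  · have hx' : x ∉ tsupport χ := by rw [tsupport, hs]; exact fun h => hx (hOU h)
    have : (fun x => χ x • F x) =ᶠ[𝓝 x] fun _ => 0 := by
      filter_upwards [notMem_tsupport_iff_eventuallyEq.1 hx'] with y hy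
      simp [hy]
    exact contDiffAt_const.congr_of_eventuallyEq this

/-- Global existence for a `C¹` vector field on an open set with a Lyapunov function whose
sublevel sets are compact, and uniqueness of forward solutions. -/
theorem exists_global_of_lyapunov {E : Type*} [NormedAddCommGroup E] [NormedSpace ℝ E]
    [FiniteDimensional ℝ E] {F : E → E} {U : Set E} (hU : IsOpen U) (hF : ContDiffOn ℝ 1 F U)
    {H W : E → ℝ} (hW : ∀ x ∈ U, 0 ≤ W x)
    (hH : ∀ x ∈ U, ∃ H' : E →L[ℝ] ℝ, HasFDerivAt H H' x ∧ H' (F x) = - W x)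
    (hK : ∀ c, IsCompact {x | x ∈ U ∧ H x ≤ c}) {x₀ : E} (hx₀ : x₀ ∈ U) :
    ∃ x : ℝ → E, x 0 = x₀ ∧
      (∀ t, 0 ≤ t → x t ∈ U ∧ HasDerivAt x (F (x t)) t) ∧
      ∀ (T : ℝ) (y : ℝ → E), 0 ≤ T → (∀ t ∈ Icc 0 T, y t ∈ U) →
        (∀ t ∈ Icc 0 T, HasDerivWithinAt y (F (y t)) (Ici 0) t) → y 0 = x₀ → y T = x T := by
  set K := {x | x ∈ U ∧ H x ≤ H x₀}
  have hx₀K : x₀ ∈ K := ⟨hx₀, le_rfl⟩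
  obtain ⟨χ, hχ0, hχ1, hG, hGc⟩ := hF.exists_cutoff hU (hK (H x₀)) (fun x hx => hx.1)
  obtain ⟨x, h0, hx⟩ := hG.exists_global_integralCurve hGc x₀
  have hxc : Continuous x := continuous_iff_continuousAt.2 fun t => (hx t).continuousAt
  have hmem : ∀ T, 0 ≤ T → x T ∈ K := by
    intro T hT
    -- Continuous induction: the set of times spent in `K` is closed, and it is open to the right
    -- because `H` does not increase while the curve is in `U`. The cutoff only multiplies the decay
    -- rate by χ ≥ 0.
    have hcl : IsClosed (x ⁻¹' K ∩ Icc 0 T) :=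
      ((hK (H x₀)).isClosed.preimage hxc).inter isClosed_Icc
    refine hcl.Icc_subset_of_forall_mem_nhdsWithin (by simpa [h0] using hx₀K) ?_
      (right_mem_Icc.2 hT)
    rintro t ⟨ht, -⟩
    have hnh : x ⁻¹' U ∈ 𝓝 t := (hU.preimage hxc).mem_nhds ht.1
    obtain ⟨ε, hε, hεU⟩ := Metric.mem_nhds_iff.1 hnh
    have hder : ∀ s ∈ Ico t (t + ε), HasDerivAt (fun s => H (x s)) (- (χ (x s) * W (x s))) s := by
      intro s hs
      have hsU : x s ∈ U := hεU (by
        rw [Metric.mem_ball, Real.dist_eq, abs_lt]; constructor <;> linarith [hs.1, hs.2])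
      obtain ⟨H', h1, h2⟩ := hH _ hsU
      have := h1.comp_hasDerivAt s (hx s)
      simpa [h2, Function.comp_def] using this
    have hanti : AntitoneOn (fun s => H (x s)) (Ico t (t + ε)) := by
      refine antitoneOn_of_deriv_nonpos (convex_Ico _ _)
        (fun s hs => (hder s hs).continuousAt.continuousWithinAt)
        (fun s hs => (hder s (interior_subset hs)).differentiableAt.differentiableWithinAt) ?_
      intro s hs
      have hs' := interior_subset hs
      rw [(hder s hs').deriv, neg_nonpos]
      refine mul_nonneg (hχ0 _) (hW _ (hεU ?_))
      rw [Metric.mem_ball, Real.dist_eq, abs_lt]; constructor <;> linarith [hs'.1, hs'.2]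
    filter_upwards [Ioo_mem_nhdsGT (show t < t + ε by linarith)] with s hs
    refine ⟨hεU ?_, (hanti ⟨le_rfl, by linarith⟩ ⟨hs.1.le, hs.2⟩ hs.1.le).trans ht.2⟩
    rw [Metric.mem_ball, Real.dist_eq, abs_lt]; constructor <;> linarith [hs.1, hs.2]
  refine ⟨x, h0, fun t ht => ⟨(hmem t ht).1, ?_⟩, ?_⟩
  · have := hx t
    rwa [hχ1 _ (hmem t ht), one_smul] at this
  intro T y hT hyU hy hy0
  have hyH : ∀ t ∈ Icc 0 T, HasDerivWithinAt (fun s => H (y s)) (- W (y t)) (Icc 0 T) t := by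
    intro t ht
    obtain ⟨H', h1, h2⟩ := hH _ (hyU t ht)
    have := h1.comp_hasDerivWithinAt t ((hy t ht).mono (Icc_subset_Ici_self : Icc 0 T ⊆ Ici 0))
    rwa [h2] at this
  -- Any competitor also stays in `K`, where the cutoff field equals `F`, so uniqueness for the
  -- globally Lipschitz field applies.
  have hyK : ∀ t ∈ Icc 0 T, y t ∈ K := by
    have hanti : AntitoneOn (fun s => H (y s)) (Icc 0 T) := by
      refine antitoneOn_of_hasDerivWithinAt_nonpos (convex_Icc _ _)
        (fun s hs => (hyH s hs).continuousWithinAt)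
        (fun s hs => (hyH s (interior_subset hs)).mono interior_subset) ?_
      intro s hs
      exact neg_nonpos.2 (hW _ (hyU s (interior_subset hs)))
    intro t ht
    refine ⟨hyU t ht, ?_⟩
    simpa [hy0] using hanti (left_mem_Icc.2 hT) ht ht.1
  obtain ⟨C, hC⟩ := ContDiff.lipschitzWith_of_hasCompactSupport hGc hG one_ne_zero
  refine ODE_solution_unique (v := fun _ x => χ x • F x) (fun _ => hC) (a := 0) (b := T) ?_ ?_
    hxc.continuousOn (fun t _ => (hx t).hasDerivWithinAt) (by rw [hy0, h0]) (right_mem_Icc.2 hT)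
  · exact fun t ht => (hy t ht).continuousWithinAt.mono Icc_subset_Ici_self
  · intro t ht
    have := (hy t (Ico_subset_Icc_self ht)).mono (Ici_subset_Ici.2 ht.1)
    simpa [hχ1 _ (hyK t (Ico_subset_Icc_self ht))] using this

/-! ### Uniform positivity and continuity of infima. -/

/-- A continuous function on `U` that is positive on `U` and bounded below by a positive constant
off a compact subset is bounded below by a positive constant. -/
theorem exists_pos_le_of_isCompact {X : Type*} [TopologicalSpace X] {U K : Set X}
    {φ : X → ℝ} (hK : IsCompact K) (hKU : K ⊆ U) (hφ : ContinuousOn φ U)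
    (hpos : ∀ x ∈ U, 0 < φ x) {c : ℝ} (hc : 0 < c) (hoff : ∀ x ∈ U, x ∉ K → c ≤ φ x) :
    ∃ m, 0 < m ∧ ∀ x ∈ U, m ≤ φ x := by
  rcases K.eq_empty_or_nonempty with rfl | hne
  · exact ⟨c, hc, fun x hx => hoff x hx (by simp)⟩
  · obtain ⟨z, hz, hmin⟩ := hK.exists_isMinOn hne (hφ.mono hKU)
    refine ⟨min c (φ z), lt_min hc (hpos z (hKU hz)), fun x hx => ?_⟩
    by_cases hxK : x ∈ K
    · exact (min_le_right _ _).trans (hmin hxK)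
    · exact (min_le_left _ _).trans (hoff x hx hxK)

/-- An infimum of 1-Lipschitz functions bounded below is 1-Lipschitz. This makes both penalised
infima below continuous. -/
theorem continuous_iInf_of_le_add_abs {ι : Type*} [Nonempty ι] {φ : ι → ℝ → ℝ}
    (h0 : ∀ i r, 0 ≤ φ i r) (h1 : ∀ i r r', φ i r ≤ φ i r' + |r - r'|) :
    Continuous fun r => ⨅ i, φ i r := by
  have hb : ∀ r, BddBelow (range fun i => φ i r) := fun r => ⟨0, by rintro _ ⟨i, rfl⟩; exact h0 i r⟩
  have key : ∀ r r', (⨅ i, φ i r) - |r - r'| ≤ ⨅ i, φ i r' := fun r r' =>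
    le_ciInf fun i => by linarith [ciInf_le (hb r) i, h1 i r r']
  refine LipschitzWith.continuous (K := 1) (LipschitzWith.of_dist_le_mul fun r r' => ?_)
  rw [Real.dist_eq, Real.dist_eq, NNReal.coe_one, one_mul, abs_le]
  constructor
  · linarith [key r' r, abs_sub_comm r r']
  · linarith [key r r']

/-! ### Construction of the comparison functions. -/

namespace RingRoad

/-- A bounded `d` that is controlled by `H` near its zeros satisfies `a (d x) ≤ H x` for some `a`
of class `K∞`. -/
theorem exists_classKInf {X : Type*} {U : Set X} {H d : X → ℝ} {D : ℝ} (hH : ∀ x ∈ U, 0 ≤ H x)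
    (hD : ∀ x ∈ U, d x ≤ D) (hpos : ∀ r, 0 < r → ∃ m, 0 < m ∧ ∀ x ∈ U, m ≤ H x + max (r - d x) 0)
    (hne : U.Nonempty) :
    ∃ a, ClassKInf a ∧ ∀ x ∈ U, 0 ≤ d x → a (d x) ≤ H x := by
  have : Nonempty U := hne.to_subtype
  -- The penalty vanishes at r = d x, so the infimum over x is at most `H x` there; it is at least r
  -- - D, hence unbounded.
  set φ : U → ℝ → ℝ := fun x r => H x + max (r - d x) 0
  have h0 : ∀ i r, 0 ≤ φ i r := fun i r => add_nonneg (hH _ i.2) (le_max_right _ _)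
  have hb : ∀ r, BddBelow (range fun i => φ i r) := fun r => ⟨0, by rintro _ ⟨i, rfl⟩; exact h0 i r⟩
  set A : ℝ → ℝ := fun r => ⨅ i, φ i r
  have hAc : Continuous A := continuous_iInf_of_le_add_abs h0 fun i r r' => by
    have : max (r - d i) 0 ≤ max (r' - d i) 0 + |r - r'| := by
      refine max_le ?_ (by positivity)
      linarith [le_max_left (r' - d i) 0, le_abs_self (r - r')]
    simp only [φ]; linarith
  have hA0 : ∀ r, 0 ≤ A r := fun r => Real.iInf_nonneg fun i => h0 i r
  have hAm : Monotone A := fun r r' h => ciInf_mono (hb r) fun i => by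
    simp only [φ]; gcongr
  have hAp : ∀ r, 0 < r → 0 < A r := fun r hr => by
    obtain ⟨m, hm, hm'⟩ := hpos r hr
    exact hm.trans_le (le_ciInf fun i => hm' i i.2)
  have hAD : ∀ r, r - D ≤ A r := fun r => le_ciInf fun i => by
    simp only [φ]
    linarith [hH i i.2, hD i i.2, le_max_left (r - d i) 0]
  -- `A` is only monotone; the factor r/(1 + r) ≤ 1 makes it strictly increasing and zero at 0.
  refine ⟨fun r => A r * (r / (1 + r)), ⟨⟨?_, ?_, by simp⟩, ?_⟩, fun x hx hd => ?_⟩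
  · refine hAc.continuousOn.mul (continuousOn_id.div (by fun_prop) fun r hr => ?_)
    have : (0 : ℝ) ≤ r := hr
    positivity
  · intro r hr r' hr' h
    have hr : (0 : ℝ) ≤ r := hr
    have hr' : (0 : ℝ) < r' := hr.trans_lt h
    have hlt : r / (1 + r) < r' / (1 + r') := by
      rw [div_lt_div_iff₀ (by positivity) (by positivity)]; nlinarith
    calc A r * (r / (1 + r)) ≤ A r' * (r / (1 + r)) := by gcongr; exact hAm h.le
      _ < A r' * (r' / (1 + r')) := by gcongr; exact hAp _ hr'
  · have hlim : Tendsto (fun r : ℝ => (r - D) / 2) atTop atTop :=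
      (tendsto_atTop_add_const_right _ _ tendsto_id).atTop_div_const two_pos
    refine tendsto_atTop_mono' _ ?_ hlim
    filter_upwards [eventually_ge_atTop 1] with r hr
    have : (1 : ℝ) / 2 ≤ r / (1 + r) := by
      rw [div_le_div_iff₀ (by positivity) (by positivity)]; linarith
    calc (r - D) / 2 ≤ A r * (1 / 2) := by linarith [hAD r]
      _ ≤ A r * (r / (1 + r)) := by gcongr; exact hA0 r
  · have h1 : A (d x) ≤ H x := by
      have := ciInf_le (hb (d x)) ⟨x, hx⟩
      simpa [φ] using this
    have h2 : d x / (1 + d x) ≤ 1 := by rw [div_le_one (by positivity)]; linarith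
    calc A (d x) * (d x / (1 + d x)) ≤ A (d x) * 1 := by gcongr; exact hA0 _
      _ ≤ H x := by linarith

/-- Differential inequalities `y' ≤ -ρ(y)` with positive definite `ρ` have a common class `KL`
bound. -/
theorem exists_classKL {ρ : ℝ → ℝ} (hc : Continuous ρ) (h0 : ∀ h, 0 ≤ h → 0 ≤ ρ h)
    (hpos : ∀ h, 0 < h → 0 < ρ h) (hle : ∀ h, 0 < h → ρ h ≤ h) :
    ∃ σ, ClassKL σ ∧ ∀ (y y' : ℝ → ℝ) (T : ℝ), 0 ≤ T → (∀ t ∈ Icc 0 T, 0 ≤ y t) →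
      (∀ t ∈ Icc 0 T, HasDerivWithinAt y (y' t) (Icc 0 T) t) →
      (∀ t ∈ Icc 0 T, y' t ≤ - ρ (y t)) → y T ≤ σ (y 0) T := by
  -- In the variable u = log y the inequality becomes (g(u))' ≤ -1 for the primitive `g` of `k`.
  -- Since ρ(h) ≤ h, k ≥ 1 and `g` is a bijection of ℝ; its inverse is therefore defined for all
  -- times.
  set k : ℝ → ℝ := fun u => Real.exp u / ρ (Real.exp u)
  have hk : Continuous k := Real.continuous_exp.div (hc.comp Real.continuous_exp)
    fun u => (hpos _ (Real.exp_pos u)).ne'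
  have hk1 : ∀ u, 1 ≤ k u := fun u => by
    rw [le_div_iff₀ (hpos _ (Real.exp_pos u)), one_mul]; exact hle _ (Real.exp_pos u)
  set g : ℝ → ℝ := fun u => ∫ w in (0 : ℝ)..u, k w
  have hg : ∀ u, HasDerivAt g (k u) u := fun u => hk.integral_hasStrictDerivAt 0 u |>.hasDerivAt
  have hgc : Continuous g := continuous_iff_continuousAt.2 fun u => (hg u).continuousAt
  have hgm : Monotone fun u => g u - u := by
    refine monotone_of_hasDerivAt_nonneg (f' := fun u => k u - 1)
      (fun u => (hg u).sub (hasDerivAt_id u)) fun u => ?_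
    simpa using hk1 u
  have hgs : StrictMono g := fun u v h => by
    have := hgm h.le
    simp only at this; linarith
  have hsurj : Function.Surjective g := by
    refine hgc.surjective ?_ ?_
    · refine tendsto_atTop_mono' _ ?_ (tendsto_atTop_add_const_right _ (g 0) tendsto_id)
      filter_upwards [eventually_ge_atTop 0] with u hu
      have := hgm hu
      simp only [id] at this ⊢; linarith
    · refine tendsto_atBot_mono' _ ?_ (tendsto_atBot_add_const_right _ (g 0) tendsto_id)
      filter_upwards [eventually_le_atBot 0] with u hu
      have := hgm hu
      simp only [id] at this ⊢; linarith
  set G : ℝ ≃o ℝ := hgs.orderIsoOfSurjective g hsurj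
  have hGg : ∀ u, G u = g u := fun u => rfl
  have hGc : Continuous G := G.continuous
  have hGsc : Continuous G.symm := G.symm.continuous
  set τ : ℝ → ℝ → ℝ := fun r t => Real.exp (G.symm (G (Real.log r) - t))
  -- `Real.log 0 = 0` would give a wrong value at r = 0. Continuity there follows from 0 ≤ σ r t ≤
  -- r.
  set σ : ℝ → ℝ → ℝ := fun r t => if 0 < r then τ r t else 0
  have hσp : ∀ r t, 0 < r → σ r t = τ r t := fun r t hr => if_pos hr
  have hσ0 : ∀ t, σ 0 t = 0 := fun t => if_neg (lt_irrefl _)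
  have hσn : ∀ r t, 0 ≤ σ r t := fun r t => by
    simp only [σ]; split_ifs; exacts [(Real.exp_pos _).le, le_rfl]
  have hσr : ∀ r t, 0 ≤ r → 0 ≤ t → σ r t ≤ r := fun r t hr ht => by
    rcases hr.eq_or_lt with rfl | hr
    · rw [hσ0]
    · rw [hσp r t hr]
      calc τ r t ≤ Real.exp (G.symm (G (Real.log r))) :=
            Real.exp_le_exp.2 (G.symm.monotone (by linarith))
        _ = r := by rw [G.symm_apply_apply, Real.exp_log hr]
  have hσc : ContinuousOn (fun p : ℝ × ℝ => σ p.1 p.2) (Ici 0 ×ˢ Ici 0) := by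
    rintro ⟨r, t⟩ ⟨hr, ht⟩
    have hr : (0 : ℝ) ≤ r := hr
    rcases hr.eq_or_lt with rfl | hr
    · have h1 : Tendsto (fun p : ℝ × ℝ => p.1) (𝓝[Ici 0 ×ˢ Ici 0] ((0 : ℝ), t)) (𝓝 0) :=
        (continuous_fst.tendsto ((0 : ℝ), t)).mono_left nhdsWithin_le_nhds
      rw [ContinuousWithinAt]
      simp only [hσ0]
      refine tendsto_of_tendsto_of_tendsto_of_le_of_le' tendsto_const_nhds h1
        (Eventually.of_forall fun p => hσn _ _) ?_
      filter_upwards [self_mem_nhdsWithin] with p hp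
      exact hσr _ _ hp.1 hp.2
    · have h1 : ContinuousAt (fun p : ℝ × ℝ => τ p.1 p.2) (r, t) := by
        have hl : ContinuousAt (fun p : ℝ × ℝ => Real.log p.1) (r, t) :=
          continuousAt_fst.log hr.ne'
        exact Real.continuous_exp.continuousAt.comp (hGsc.continuousAt.comp
          ((hGc.continuousAt.comp hl).sub continuousAt_snd))
      refine (h1.congr ?_).continuousWithinAt
      filter_upwards [continuousAt_fst.eventually (lt_mem_nhds hr)] with p hp
      exact (hσp _ _ hp).symm
  have hKL : ClassKL σ := by
    refine ⟨hσc, fun t ht => ⟨?_, ?_, hσ0 t⟩, ?_, ?_⟩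
    · exact hσc.comp (by fun_prop : Continuous fun r : ℝ => (r, t)).continuousOn
        fun r hr => ⟨hr, ht⟩
    · intro r hr r' hr' h
      have hr : (0 : ℝ) ≤ r := hr
      have hr' : 0 < r' := hr.trans_lt h
      simp only
      rw [hσp r' t hr']
      rcases hr.eq_or_lt with rfl | hr
      · rw [hσ0]; exact Real.exp_pos _
      · rw [hσp r t hr]
        refine Real.exp_lt_exp.2 (G.symm.strictMono ?_)
        have := G.strictMono (Real.log_lt_log hr h)
        linarith
    · intro r hr t ht t' ht' h
      rcases hr.eq_or_lt with rfl | hr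
      · rw [hσ0, hσ0]
      · rw [hσp _ _ hr, hσp _ _ hr]
        exact Real.exp_le_exp.2 (G.symm.monotone (by linarith))
    · intro r hr
      rcases hr.eq_or_lt with rfl | hr
      · exact tendsto_const_nhds.congr fun t => (hσ0 t).symm
      · have : σ r = τ r := funext fun t => hσp r t hr
        rw [this]
        exact Real.tendsto_exp_atBot.comp (G.symm.tendsto_atBot.comp
          (tendsto_atBot_add_const_left _ _ tendsto_neg_atTop_atBot))
  refine ⟨σ, hKL, fun y y' T hT hy hd hi => ?_⟩
  have hT' : T ∈ Icc 0 T := right_mem_Icc.2 hT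
  -- If y T > 0 then, y being antitone, y is positive on all of [0, T] and its logarithm is
  -- differentiable.
  rcases (hy T hT').eq_or_lt with h | hyT
  · rw [← h]; exact hσn _ _
  have hanti : AntitoneOn y (Icc 0 T) := by
    refine antitoneOn_of_hasDerivWithinAt_nonpos (convex_Icc _ _)
      (fun s hs => (hd s hs).continuousWithinAt)
      (fun s hs => (hd s (interior_subset hs)).mono interior_subset) ?_
    intro s hs
    have hs' := interior_subset hs
    linarith [hi s hs', h0 _ (hy s hs')]
  have hyp : ∀ t ∈ Icc 0 T, 0 < y t := fun t ht => hyT.trans_le (hanti ht hT' ht.2)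
  have hφ : ∀ t ∈ Icc 0 T, HasDerivWithinAt (fun t => g (Real.log (y t)) + t)
      (k (Real.log (y t)) * (y' t / y t) + 1) (Icc 0 T) t := fun t ht =>
    ((hg _).comp_hasDerivWithinAt t ((hd t ht).log (hyp t ht).ne')).add (hasDerivWithinAt_id _ _)
  have hanti' : AntitoneOn (fun t => g (Real.log (y t)) + t) (Icc 0 T) := by
    refine antitoneOn_of_hasDerivWithinAt_nonpos (convex_Icc _ _)
      (fun s hs => (hφ s hs).continuousWithinAt)
      (fun s hs => (hφ s (interior_subset hs)).mono interior_subset) ?_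
    intro s hs
    have hs' := interior_subset hs
    have hys := hyp s hs'
    have hρ := hpos _ hys
    simp only [k]
    rw [Real.exp_log hys, div_mul_div_comm, mul_comm (y s), mul_div_mul_right _ _ hys.ne']
    have : y' s / ρ (y s) ≤ -1 := by
      rw [div_le_iff₀ hρ]; linarith [hi s hs']
    linarith
  have hfin := hanti' (left_mem_Icc.2 hT) hT' hT
  have hy0 := hyp 0 (left_mem_Icc.2 hT)
  rw [hσp _ _ hy0, ← Real.exp_log hyT]
  refine Real.exp_le_exp.2 ?_
  rw [OrderIso.le_symm_apply, hGg, hGg]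
  simp only at hfin
  linarith

/-- A function `W` that dominates a positive definite function of `H` on all sublevel sets
dominates a continuous one globally. -/
theorem exists_posDef_le {X : Type*} {U : Set X} {H W : X → ℝ} (hW : ∀ x ∈ U, 0 ≤ W x)
    (hpos : ∀ h, 0 < h → ∃ m, 0 < m ∧ ∀ x ∈ U, m ≤ W x + |h - H x|)
    {e : X} (he : e ∈ U) (hHe : H e = 0) (hWe : W e = 0) :
    ∃ ρ : ℝ → ℝ, Continuous ρ ∧ (∀ h, 0 ≤ ρ h) ∧ (∀ h, 0 < h → 0 < ρ h) ∧
      (∀ h, 0 < h → ρ h ≤ h) ∧ ∀ x ∈ U, ρ (H x) ≤ W x := by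
  have : Nonempty U := ⟨⟨e, he⟩⟩
  -- The infimum over x is the candidate ρ: taking x with H x = h bounds it by `W x`, taking x = e
  -- bounds it by h.
  set φ : U → ℝ → ℝ := fun x h => W x + |h - H x|
  have h0 : ∀ i r, 0 ≤ φ i r := fun i r => add_nonneg (hW _ i.2) (abs_nonneg _)
  have hb : ∀ r, BddBelow (range fun i => φ i r) := fun r => ⟨0, by rintro _ ⟨i, rfl⟩; exact h0 i r⟩
  refine ⟨fun r => ⨅ i, φ i r, continuous_iInf_of_le_add_abs h0 fun i r r' => ?_,
    fun r => Real.iInf_nonneg fun i => h0 i r, fun r hr => ?_, fun r hr => ?_, fun x hx => ?_⟩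
  · simp only [φ]
    linarith [abs_sub_le r r' (H i)]
  · obtain ⟨m, hm, hm'⟩ := hpos r hr
    exact hm.trans_le (le_ciInf fun i => hm' i i.2)
  · have := ciInf_le (hb r) ⟨e, he⟩
    simpa [φ, hHe, hWe, abs_of_pos hr] using this
  · have := ciInf_le (hb (H x)) ⟨x, hx⟩
    simpa [φ] using this

end RingRoad

/-! ### Regularity of the closed loop and the dissipation identity. -/

namespace RingRoad

variable {n : ℕ} [NeZero n] {P : Params}

theorem sum_add_one (g : Fin n → ℝ) : ∑ i, g (i + 1) = ∑ i, g i :=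
  Equiv.sum_comp (Equiv.addRight (1 : Fin n)) g

theorem sum_sub_one (g : Fin n → ℝ) : ∑ i, g (i - 1) = ∑ i, g i :=
  Equiv.sum_comp (Equiv.subRight (1 : Fin n)) g

theorem sum_eq_zero_add_sum_ne (g : Fin n → ℝ) :
    ∑ i, g i = g 0 + ∑ j : {i : Fin n // i ≠ 0}, g j := by
  rw [← Finset.add_sum_erase _ g (Finset.mem_univ 0)]
  congr 1
  exact Finset.sum_subtype _ (by simp) g

theorem sum_spacing (x : State n) : ∑ i, spacing P x i = P.R := by
  rw [sum_eq_zero_add_sum_ne]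
  have : ∀ j : {i : Fin n // i ≠ 0}, spacing P x j = x (Sum.inl j) := fun j => by
    simp [spacing, j.2]
  simp only [this]
  simp [spacing]

theorem contDiff_spacing {m : WithTop ℕ∞} (i : Fin n) :
    ContDiff ℝ m (fun x : State n => spacing P x i) := by
  unfold spacing
  split_ifs <;> fun_prop

theorem contDiff_speed {m : WithTop ℕ∞} (i : Fin n) :
    ContDiff ℝ m (fun x : State n => speed x i) := by
  unfold speed; fun_prop

/-- The first spacing is not a coordinate, but relative speeds sum to zero around the ring, so it
obeys the same law as the others. -/
theorem spacing_add_smul_closedLoop (x : State n) (t : ℝ) (i : Fin n) :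
    spacing P (x + t • closedLoop P x) i =
      spacing P x i + t * (speed x (i - 1) - speed x i) := by
  have hs : ∀ j : {i : Fin n // i ≠ 0}, (x + t • closedLoop P x) (Sum.inl j) =
      x (Sum.inl j) + t * (speed x (j - 1) - speed x j) := fun j => by
    simp [closedLoop]
  by_cases h : i = 0
  · subst h
    have h0 : ∑ i, (speed x (i - 1) - speed x i) = 0 := by
      rw [Finset.sum_sub_distrib, sum_sub_one, sub_self]
    rw [sum_eq_zero_add_sum_ne] at h0
    simp only [spacing, dif_pos, hs, Finset.sum_add_distrib, ← Finset.mul_sum]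
    linear_combination (-t) * h0
  · simp only [spacing, dif_neg h, hs]

theorem speed_add_smul_closedLoop (x : State n) (t : ℝ) (i : Fin n) :
    speed (x + t • closedLoop P x) i = speed x i + t * accel P x i := by
  simp [speed, closedLoop]

theorem isOpen_Omega : IsOpen (Omega P n) := by
  have : Omega P n = (⋂ i, {x | P.L < spacing P x i}) ∩
      ⋂ i, ({x | 0 < speed x i} ∩ {x | speed x i < P.vmax}) := by
    ext x; simp [Omega]
  rw [this]
  refine (isOpen_iInter_of_finite fun i => ?_).inter (isOpen_iInter_of_finite fun i => ?_)
  · exact isOpen_lt continuous_const (contDiff_spacing (m := 0) i).continuous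
  · exact (isOpen_lt continuous_const (contDiff_speed (m := 0) i).continuous).inter
      (isOpen_lt (contDiff_speed (m := 0) i).continuous continuous_const)

theorem spacing_le_of_mem_Omega (hL : 0 < P.L) {x : State n} (hx : x ∈ Omega P n) (i : Fin n) :
    spacing P x i ≤ P.R := by
  rw [← sum_spacing (P := P) x]
  exact Finset.single_le_sum (f := fun i => spacing P x i)
    (fun j _ => (hL.trans (hx.1 j)).le) (Finset.mem_univ i)

theorem isBounded_Omega (hL : 0 < P.L) : Bornology.IsBounded (Omega P n) := by
  refine (isBounded_iff_forall_norm_le).2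
    ⟨Real.sqrt (∑ _i : {i : Fin n // i ≠ 0} ⊕ Fin n, (P.R + P.vmax) ^ 2), fun x hx => ?_⟩
  rw [EuclideanSpace.norm_eq]
  refine Real.sqrt_le_sqrt (Finset.sum_le_sum fun i _ => ?_)
  rw [Real.norm_eq_abs, sq_abs]
  have hR : 0 < P.R := (hL.trans (hx.1 0)).trans_le (spacing_le_of_mem_Omega hL hx 0)
  have hM : 0 < P.vmax := (hx.2 0).1.trans (hx.2 0).2
  have key : 0 ≤ x i ∧ x i ≤ P.R + P.vmax := by
    rcases i with j | i
    · have h1 := spacing_le_of_mem_Omega hL hx j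
      have h2 := hx.1 j
      simp only [spacing, dif_neg j.2] at h1 h2
      exact ⟨(hL.trans h2).le, by linarith⟩
    · have := hx.2 i
      simp only [speed] at this
      exact ⟨this.1.le, by linarith [this.2]⟩
  exact pow_le_pow_left₀ key.1 key.2 2

/-- The difference of the potential forces acting on vehicle `i`. -/
def forceGap (P : Params) (x : State n) (i : Fin n) : ℝ :=
  deriv P.V (spacing P x (i + 1)) - deriv P.V (spacing P x i)

/-- The dissipation rate of `H` along the closed-loop system. -/
def dissipation (P : Params) (x : State n) : ℝ :=
  P.μ * P.vmax ^ 2 * ∑ i, (speed x i - f P x i) ^ 2 / (speed x i * (P.vmax - speed x i))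
    + ∑ i, forceGap P x i * P.b (forceGap P x i)

theorem f_mem_Ioo (hb : AdmissibleB P) (x : State n) (i : Fin n) :
    f P x i ∈ Ioo 0 P.vmax := by
  have := hb.mem (deriv P.V (spacing P x (i + 1)) - deriv P.V (spacing P x i))
  constructor <;> simp only [f] <;> linarith [this.1, this.2]

theorem beta_pos {v y : ℝ} (hv : v ∈ Ioo 0 P.vmax) (hy : y ∈ Ioo 0 P.vmax) :
    0 < beta P v y := by
  have h1 : 0 < P.vmax - v := sub_pos.2 hv.2
  have h2 : 0 < P.vmax - y := sub_pos.2 hy.2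
  have h3 := hv.1
  have h4 := hy.1
  have hM : 0 < P.vmax := hv.1.trans hv.2
  unfold beta
  -- This form shows the numerator as a sum of positive terms.
  have : P.vmax ^ 3 * (v + y) - 2 * P.vmax ^ 2 * y * v =
      P.vmax ^ 2 * (v * (P.vmax - y) + y * (P.vmax - v)) := by ring
  rw [this]
  positivity

theorem contDiffOn_deriv_V (hV : AdmissiblePotential P) :
    ContDiffOn ℝ 2 (deriv P.V) (Ioi P.L) :=
  hV.contDiffOn.deriv_of_isOpen isOpen_Ioi (by norm_num)

theorem contDiffOn_deriv_deriv_V (hV : AdmissiblePotential P) :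
    ContDiffOn ℝ 1 (deriv (deriv P.V)) (Ioi P.L) :=
  (contDiffOn_deriv_V hV).deriv_of_isOpen isOpen_Ioi (by norm_num)

theorem contDiffOn_comp_spacing {g : ℝ → ℝ} {m : WithTop ℕ∞} (hg : ContDiffOn ℝ m g (Ioi P.L))
    (i : Fin n) : ContDiffOn ℝ m (fun x : State n => g (spacing P x i)) (Omega P n) :=
  hg.comp (contDiff_spacing i).contDiffOn fun _ hx => hx.1 i

theorem contDiffOn_forceGap (hV : AdmissiblePotential P) (i : Fin n) :
    ContDiffOn ℝ 1 (fun x => forceGap P x i) (Omega P n) :=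
  ((contDiffOn_comp_spacing (contDiffOn_deriv_V hV) (i + 1)).sub
    (contDiffOn_comp_spacing (contDiffOn_deriv_V hV) i)).of_le (by norm_num)

theorem contDiffOn_f (hV : AdmissiblePotential P) (hb : AdmissibleB P) (i : Fin n) :
    ContDiffOn ℝ 1 (fun x => f P x i) (Omega P n) :=
  contDiffOn_const.sub ((hb.contDiff.of_le (by norm_num)).comp_contDiffOn (contDiffOn_forceGap hV i))

theorem speed_mul_pos {x : State n} (hx : x ∈ Omega P n) (i : Fin n) :
    0 < speed x i * (P.vmax - speed x i) :=
  mul_pos (hx.2 i).1 (sub_pos.2 (hx.2 i).2)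

theorem contDiffOn_quotient {g : State n → ℝ} (hg : ContDiffOn ℝ 1 g (Omega P n)) (i : Fin n) :
    ContDiffOn ℝ 1 (fun x => g x / (speed x i * (P.vmax - speed x i))) (Omega P n) :=
  hg.div ((contDiff_speed i).mul (contDiff_const.sub (contDiff_speed i))).contDiffOn
    fun _ hx => (speed_mul_pos hx i).ne'

theorem contDiffOn_H (hV : AdmissiblePotential P) (hb : AdmissibleB P) :
    ContDiffOn ℝ 1 (H P) (Omega P n) := by
  refine (contDiffOn_const.mul (ContDiffOn.sum fun i _ => contDiffOn_quotient ?_ i)).add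
    (ContDiffOn.sum fun i _ => ?_)
  · exact ((contDiff_speed i).contDiffOn.sub (contDiffOn_f hV hb i)).pow 2
  · exact contDiffOn_comp_spacing (hV.contDiffOn.of_le (by norm_num)) i

theorem continuousOn_dissipation (hV : AdmissiblePotential P) (hb : AdmissibleB P) :
    ContinuousOn (dissipation P) (Omega P n) := by
  refine (contDiffOn_const.mul (ContDiffOn.sum fun i _ => contDiffOn_quotient ?_ i)).continuousOn.add
    (continuousOn_finsetSum _ fun i _ => ?_)
  · exact ((contDiff_speed i).contDiffOn.sub (contDiffOn_f hV hb i)).pow 2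
  · exact (contDiffOn_forceGap hV i).continuousOn.mul
      (hb.contDiff.continuous.comp_continuousOn (contDiffOn_forceGap hV i).continuousOn)

theorem contDiffOn_accel (hV : AdmissiblePotential P) (hb : AdmissibleB P) (i : Fin n) :
    ContDiffOn ℝ 1 (fun x => accel P x i) (Omega P n) := by
  have hf := contDiffOn_f hV hb i (n := n)
  have hv : ∀ i : Fin n, ContDiffOn ℝ 1 (fun x : State n => speed x i) (Omega P n) :=
    fun i => (contDiff_speed i).contDiffOn
  have hV1 : ∀ i : Fin n, ContDiffOn ℝ 1 (fun x : State n => deriv P.V (spacing P x i)) (Omega P n) :=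
    fun i => contDiffOn_comp_spacing ((contDiffOn_deriv_V hV).of_le (by norm_num)) i
  have hV2 : ∀ i : Fin n,
      ContDiffOn ℝ 1 (fun x : State n => deriv (deriv P.V) (spacing P x i)) (Omega P n) :=
    fun i => contDiffOn_comp_spacing (contDiffOn_deriv_deriv_V hV) i
  have hb' : ContDiff ℝ 1 (deriv P.b) :=
    ((contDiff_succ_iff_deriv (n := 1)).1 (by simpa [one_add_one_eq_two] using hb.contDiff)).2.2
  have hbeta : ContDiffOn ℝ 1 (fun x => beta P (speed x i) (f P x i)) (Omega P n) := by
    unfold beta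
    refine ContDiffOn.div ?_ ?_ ?_
    · exact (contDiffOn_const.mul ((hv i).add hf)).sub ((contDiffOn_const.mul hf).mul (hv i))
    · exact (contDiffOn_const.mul ((contDiffOn_const.sub (hv i)).pow 2)).mul ((hv i).pow 2)
    · intro x hx
      have h1 := (hx.2 i).1
      have h2 := sub_pos.2 (hx.2 i).2
      positivity
  have hZ : ContDiffOn ℝ 1 (fun x => Z P x i) (Omega P n) :=
    (contDiffOn_const.mul (hb'.comp_contDiffOn (contDiffOn_forceGap hV i))).mul
      (((hV2 _).mul ((hv _).sub (hv _))).sub ((hV2 _).mul ((hv _).sub (hv _))))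
  refine (contDiffOn_const.div hbeta fun x hx => (beta_pos (hx.2 i) (f_mem_Ioo hb x i)).ne').mul
    (((contDiffOn_quotient ?_ i).add (hV1 _)).sub (hV1 _))
  exact hZ.sub (contDiffOn_const.mul ((hv i).sub hf))

theorem contDiffOn_closedLoop (hV : AdmissiblePotential P) (hb : AdmissibleB P) :
    ContDiffOn ℝ 1 (closedLoop P) (Omega P n) := by
  rw [contDiffOn_euclidean]
  rintro (j | i)
  · exact ((contDiff_speed _).sub (contDiff_speed _)).contDiffOn
  · exact contDiffOn_accel hV hb i

/-- `H` decreases along the closed-loop vector field at the rate `dissipation`. -/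
theorem fderiv_H_closedLoop (hV : AdmissiblePotential P) (hb : AdmissibleB P) {x : State n}
    (hx : x ∈ Omega P n) :
    ∃ H' : State n →L[ℝ] ℝ, HasFDerivAt (H P) H' x ∧ H' (closedLoop P x) = - dissipation P x := by
  have hd : DifferentiableAt ℝ (H P) x :=
    ((contDiffOn_H hV hb).differentiableOn one_ne_zero).differentiableAt (isOpen_Omega.mem_nhds hx)
  -- It suffices to differentiate `H` along the straight line x + t · closedLoop x at t = 0.
  refine ⟨_, hd.hasFDerivAt, (hd.hasFDerivAt.hasLineDerivAt _).unique ?_⟩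
  have hs : ∀ i : Fin n, HasDerivAt (fun t : ℝ => spacing P (x + t • closedLoop P x) i)
      (speed x (i - 1) - speed x i) 0 := fun i => by
    simp only [spacing_add_smul_closedLoop]
    simpa using ((hasDerivAt_id (0 : ℝ)).mul_const (speed x (i - 1) - speed x i)).const_add
      (spacing P x i)
  have hv : ∀ i : Fin n, HasDerivAt (fun t : ℝ => speed (x + t • closedLoop P x) i)
      (accel P x i) 0 := fun i => by
    simp only [speed_add_smul_closedLoop]
    simpa using ((hasDerivAt_id (0 : ℝ)).mul_const (accel P x i)).const_add (speed x i)
  have hcomp : ∀ (g : ℝ → ℝ) (i : Fin n), ContDiffOn ℝ 1 g (Ioi P.L) →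
      HasDerivAt (fun t : ℝ => g (spacing P (x + t • closedLoop P x) i))
        (deriv g (spacing P x i) * (speed x (i - 1) - speed x i)) 0 := fun g i hg => by
    have h1 : HasDerivAt g (deriv g (spacing P x i)) (spacing P (x + (0 : ℝ) • closedLoop P x) i) := by
      rw [zero_smul, add_zero]
      exact ((hg.differentiableOn one_ne_zero).differentiableAt
        (Ioi_mem_nhds (hx.1 i))).hasDerivAt
    exact h1.comp 0 (hs i)
  have hV1 := fun i => hcomp (deriv P.V) i ((contDiffOn_deriv_V hV).of_le (by norm_num))
  have hVs := fun i => hcomp P.V i (hV.contDiffOn.of_le (by norm_num))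
  have hf : ∀ i : Fin n, HasDerivAt (fun t : ℝ => f P (x + t • closedLoop P x) i)
      (Z P x i / P.vmax ^ 2) 0 := fun i => by
    have hM : P.vmax ≠ 0 := ((hx.2 0).1.trans (hx.2 0).2).ne'
    have h1 : HasDerivAt P.b (deriv P.b (forceGap P x i))
        (forceGap P (x + (0 : ℝ) • closedLoop P x) i) := by
      rw [zero_smul, add_zero]
      exact (hb.contDiff.differentiable two_ne_zero _).hasDerivAt
    have h2 := (h1.comp (0 : ℝ) ((hV1 (i + 1)).sub (hV1 i))).const_sub P.vstar
    refine h2.congr_deriv ?_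
    rw [add_sub_cancel_right]
    unfold Z forceGap
    field_simp
  -- The v-derivative of the quotient contributes `beta` times `accel`; the derivative of `f`
  -- contributes a `Z` term, which the one in `accel` cancels.
  have hterm : ∀ i : Fin n, HasDerivAt (fun t : ℝ => (speed (x + t • closedLoop P x) i -
        f P (x + t • closedLoop P x) i) ^ 2 / (speed (x + t • closedLoop P x) i *
          (P.vmax - speed (x + t • closedLoop P x) i)))
      (2 / P.vmax ^ 2 * (- (P.μ * P.vmax ^ 2 * ((speed x i - f P x i) ^ 2 /
        (speed x i * (P.vmax - speed x i)))) - (speed x i - f P x i) * forceGap P x i)) 0 := by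
    intro i
    have h1 := (hx.2 i).1.ne'
    have h2 := (sub_pos.2 (hx.2 i).2).ne'
    have hM : P.vmax ≠ 0 := ((hx.2 0).1.trans (hx.2 0).2).ne'
    have hβ := (beta_pos (hx.2 i) (f_mem_Ioo hb x i)).ne'
    have hA : beta P (speed x i) (f P x i) * accel P x i =
        (Z P x i - P.μ * P.vmax ^ 2 * (speed x i - f P x i)) / (speed x i * (P.vmax - speed x i))
          - forceGap P x i := by
      rw [accel, forceGap, ← mul_assoc, mul_one_div_cancel hβ]; ring
    have h3 := (((hv i).sub (hf i)).pow 2).div ((hv i).mul ((hv i).const_sub P.vmax))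
      (by simpa using ⟨h1, h2⟩)
    refine h3.congr_deriv ?_
    simp only [Pi.sub_apply, Pi.pow_apply, Pi.mul_apply, zero_smul, add_zero]
    have h4 : forceGap P x i = (Z P x i - P.μ * P.vmax ^ 2 * (speed x i - f P x i)) /
        (speed x i * (P.vmax - speed x i)) - beta P (speed x i) (f P x i) * accel P x i := by
      rw [hA]; ring
    rw [h4]
    unfold beta
    field_simp
    ring
  have hsum := ((HasDerivAt.fun_sum fun i (_ : i ∈ Finset.univ) => hterm i).const_mul
    (P.vmax ^ 2 / 2)).add (HasDerivAt.fun_sum fun i (_ : i ∈ Finset.univ) => hVs i)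
  refine hsum.congr_deriv ?_
  have hM : P.vmax ≠ 0 := ((hx.2 0).1.trans (hx.2 0).2).ne'
  have hc1 : ∑ i, deriv P.V (spacing P x i) * speed x (i - 1) =
      ∑ i, deriv P.V (spacing P x (i + 1)) * speed x i := by
    rw [← sum_add_one fun i => deriv P.V (spacing P x i) * speed x (i - 1)]
    simp
  have hc2 : ∑ i, forceGap P x i = 0 := by
    simp only [forceGap]
    rw [Finset.sum_sub_distrib, sum_add_one fun i => deriv P.V (spacing P x i), sub_self]
  have hc3 : ∑ i, deriv P.V (spacing P x i) * (speed x (i - 1) - speed x i) =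
      ∑ i, forceGap P x i * speed x i := by
    simp only [mul_sub, forceGap, sub_mul, Finset.sum_sub_distrib, hc1]
  have hfb : ∀ i, f P x i = P.vstar - P.b (forceGap P x i) := fun i => rfl
  -- The constant `vstar` drops out because the gaps sum to zero; the sum of gap times speed cancels
  -- the derivative of the potential energy.
  have hc4 : ∑ i, (speed x i - f P x i) * forceGap P x i =
      ∑ i, forceGap P x i * speed x i + ∑ i, forceGap P x i * P.b (forceGap P x i) := by
    have : ∀ i, (speed x i - f P x i) * forceGap P x i = forceGap P x i * speed x i +
        forceGap P x i * P.b (forceGap P x i) - P.vstar * forceGap P x i := fun i => by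
      rw [hfb]; ring
    simp only [this, Finset.sum_sub_distrib, Finset.sum_add_distrib, ← Finset.mul_sum, hc2]
    ring
  rw [hc3, ← Finset.mul_sum, Finset.sum_sub_distrib, hc4, Finset.sum_neg_distrib, ← Finset.mul_sum,
    dissipation]
  field_simp
  ring

end RingRoad

/-! ### Compactness of the sublevel sets. -/

namespace RingRoad

variable {n : ℕ} [NeZero n] {P : Params}

/-- If v < m/2 then |v - y| ≥ m/2, so the left side of `h` is at least m²M/(8v), and the bound by C
gives v ≥ m²M/(8C). -/
theorem min_le_of_quotient_le {M m v y C : ℝ} (hv : 0 < v) (hvM : v < M) (hm : 0 < m) (hy : m ≤ y)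
    (hC : 0 < C) (h : M ^ 2 / 2 * ((v - y) ^ 2 / (v * (M - v))) ≤ C) :
    min (m / 2) (m ^ 2 * M / (8 * C)) ≤ v := by
  rw [min_le_iff]
  by_contra! hlt
  obtain ⟨h1, h2⟩ := hlt
  have hM : 0 < M := hv.trans hvM
  have hMv : 0 < M - v := sub_pos.2 hvM
  rw [← mul_div_assoc, div_le_iff₀ (by positivity)] at h
  rw [lt_div_iff₀ (by positivity)] at h2
  have h3 : (m / 2) ^ 2 ≤ (v - y) ^ 2 := by
    rw [← neg_sub, neg_sq]
    exact pow_le_pow_left₀ (by positivity) (by linarith) 2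
  have h4 : M ^ 2 / 2 * (m / 2) ^ 2 ≤ C * (v * M) := by
    calc M ^ 2 / 2 * (m / 2) ^ 2 ≤ M ^ 2 / 2 * (v - y) ^ 2 := by gcongr
      _ ≤ C * (v * (M - v)) := h
      _ ≤ C * (v * M) := by gcongr; linarith
  have h5 : v * (8 * C) * M < m ^ 2 * M * M := by gcongr
  nlinarith

theorem H_term_nonneg {x : State n} (hx : x ∈ Omega P n) (i : Fin n) :
    0 ≤ (speed x i - f P x i) ^ 2 / (speed x i * (P.vmax - speed x i)) :=
  div_nonneg (sq_nonneg _) (speed_mul_pos hx i).le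

theorem V_spacing_le_H (hV : AdmissiblePotential P) {x : State n} (hx : x ∈ Omega P n) (i : Fin n) :
    P.V (spacing P x i) ≤ H P x := by
  have h1 : P.V (spacing P x i) ≤ ∑ i, P.V (spacing P x i) :=
    Finset.single_le_sum (f := fun i => P.V (spacing P x i)) (fun j _ => hV.nonneg _ (hx.1 j))
      (Finset.mem_univ i)
  have h2 : 0 ≤ ∑ i, (speed x i - f P x i) ^ 2 / (speed x i * (P.vmax - speed x i)) :=
    Finset.sum_nonneg fun j _ => H_term_nonneg hx j
  unfold H
  nlinarith [sq_nonneg P.vmax]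

theorem H_term_le_H (hV : AdmissiblePotential P) {x : State n} (hx : x ∈ Omega P n) (i : Fin n) :
    P.vmax ^ 2 / 2 * ((speed x i - f P x i) ^ 2 / (speed x i * (P.vmax - speed x i))) ≤ H P x := by
  have h1 := Finset.single_le_sum
    (f := fun i => (speed x i - f P x i) ^ 2 / (speed x i * (P.vmax - speed x i)))
    (fun j _ => H_term_nonneg hx j) (Finset.mem_univ i)
  have h2 : 0 ≤ ∑ i, P.V (spacing P x i) := Finset.sum_nonneg fun j _ => hV.nonneg _ (hx.1 j)
  unfold H
  have := mul_le_mul_of_nonneg_left h1 (show 0 ≤ P.vmax ^ 2 / 2 by positivity)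
  linarith

theorem H_nonneg (hV : AdmissiblePotential P) {x : State n} (hx : x ∈ Omega P n) : 0 ≤ H P x :=
  (hV.nonneg _ (hx.1 0)).trans (V_spacing_le_H hV hx 0)

/-- On a sublevel set of `H`, the state stays uniformly away from the boundary of `Omega`. -/
theorem exists_margin (hL : 0 < P.L) (hV : AdmissiblePotential P) (hb : AdmissibleB P) (c : ℝ) :
    ∃ δ, 0 < δ ∧ ∀ x ∈ Omega P n, H P x ≤ c →
      ∀ i, P.L + δ ≤ spacing P x i ∧ δ ≤ speed x i ∧ speed x i ≤ P.vmax - δ := by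
  obtain ⟨u, hu, hVu⟩ := mem_nhdsGT_iff_exists_Ioo_subset.1
    (hV.tendsto.eventually (eventually_gt_atTop c))
  have hu : P.L < u := hu
  obtain ⟨A, hA⟩ := isCompact_Icc.exists_bound_of_continuousOn (s := Icc u P.R)
    ((contDiffOn_deriv_V hV).continuousOn.mono fun s hs => hu.trans_le hs.1)
  set C := max c 1
  have hC : 0 < C := lt_max_of_lt_right one_pos
  -- On [u, R] the slope of V is bounded by `A`, so force gaps lie in [-2A, 2A] and monotonicity of
  -- `b` gives m ≤ f ≤ vmax - m.
  set m := min (P.vstar - P.b (2 * A)) (P.vmax - P.vstar + P.b (-(2 * A)))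
  have hm : 0 < m := lt_min (by linarith [(hb.mem (2 * A)).2]) (by linarith [(hb.mem (-(2 * A))).1])
  have hM : 0 < P.vmax := by linarith [(hb.mem 0).1, (hb.mem 0).2]
  refine ⟨min (u - P.L) (min (m / 2) (m ^ 2 * P.vmax / (8 * C))),
    lt_min (by linarith) (lt_min (by positivity) (by positivity)), fun x hx hxc i => ?_⟩
  have hs : ∀ i, u ≤ spacing P x i := fun i => by
    by_contra! h
    exact absurd ((V_spacing_le_H hV hx i).trans hxc) (not_le.2 (hVu ⟨hx.1 i, h⟩))
  have hA' : ∀ i, |deriv P.V (spacing P x i)| ≤ A := fun i =>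
    hA _ ⟨hs i, spacing_le_of_mem_Omega hL hx i⟩
  have hg : |deriv P.V (spacing P x (i + 1)) - deriv P.V (spacing P x i)| ≤ 2 * A :=
    (abs_sub _ _).trans (by linarith [hA' i, hA' (i + 1)])
  have hf1 : m ≤ f P x i := (min_le_left _ _).trans
    (sub_le_sub_left (hb.strictMono.monotone (abs_le.1 hg).2) _)
  have hf2 : m ≤ P.vmax - f P x i := by
    have := hb.strictMono.monotone (abs_le.1 hg).1
    refine (min_le_right _ _).trans ?_
    unfold f
    linarith
  have hq := ((H_term_le_H hV hx i).trans hxc).trans (le_max_left c 1)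
  refine ⟨?_, ?_, ?_⟩
  · linarith [hs i, min_le_left (u - P.L) (min (m / 2) (m ^ 2 * P.vmax / (8 * C)))]
  · exact (min_le_right _ _).trans
      (min_le_of_quotient_le (hx.2 i).1 (hx.2 i).2 hm hf1 hC hq)
  -- The quotient is invariant under v ↦ vmax - v, y ↦ vmax - y, so the lower bound on speeds also
  -- yields the upper one.
  · have hq' : P.vmax ^ 2 / 2 * ((P.vmax - speed x i - (P.vmax - f P x i)) ^ 2 /
        ((P.vmax - speed x i) * (P.vmax - (P.vmax - speed x i)))) ≤ C := by
      rw [show P.vmax - speed x i - (P.vmax - f P x i) = -(speed x i - f P x i) by ring, neg_sq,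
        show (P.vmax - speed x i) * (P.vmax - (P.vmax - speed x i)) =
          speed x i * (P.vmax - speed x i) by ring]
      exact hq
    have := min_le_of_quotient_le (sub_pos.2 (hx.2 i).2) (sub_lt_self _ (hx.2 i).1) hm hf2 hC hq'
    linarith [min_le_right (u - P.L) (min (m / 2) (m ^ 2 * P.vmax / (8 * C)))]

/-- `H` is controlled only on the open set `Omega`; the margin puts the sublevel set inside a closed
subset `B` of `Omega`, on which `H` is continuous. -/
theorem isCompact_sublevel (hL : 0 < P.L) (hV : AdmissiblePotential P) (hb : AdmissibleB P) (c : ℝ) :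
    IsCompact {x : State n | x ∈ Omega P n ∧ H P x ≤ c} := by
  obtain ⟨δ, hδ, hmar⟩ := exists_margin (n := n) hL hV hb c
  set B : Set (State n) := ⋂ i, ({x | P.L + δ ≤ spacing P x i} ∩
    ({x | δ ≤ speed x i} ∩ {x | speed x i ≤ P.vmax - δ}))
  have hBc : IsClosed B := isClosed_iInter fun i =>
    (isClosed_le continuous_const (contDiff_spacing (m := 0) i).continuous).inter
      ((isClosed_le continuous_const (contDiff_speed (m := 0) i).continuous).inter
        (isClosed_le (contDiff_speed (m := 0) i).continuous continuous_const))
  have hBΩ : B ⊆ Omega P n := fun x hx => by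
    have hx := mem_iInter.1 hx
    exact ⟨fun i => by linarith [show P.L + δ ≤ _ from (hx i).1],
      fun i => ⟨by linarith [show δ ≤ _ from (hx i).2.1],
        by linarith [show _ ≤ P.vmax - δ from (hx i).2.2]⟩⟩
  have heq : {x : State n | x ∈ Omega P n ∧ H P x ≤ c} = B ∩ H P ⁻¹' Iic c := by
    ext x
    constructor
    · rintro ⟨hx, hxc⟩
      exact ⟨mem_iInter.2 fun i => hmar x hx hxc i, hxc⟩
    · rintro ⟨hx, hxc⟩
      exact ⟨hBΩ hx, hxc⟩
  refine Metric.isCompact_of_isClosed_isBounded ?_ ((isBounded_Omega hL).subset fun x hx => hx.1)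
  rw [heq]
  exact ((contDiffOn_H hV hb).continuousOn.mono hBΩ).preimage_isClosed_of_isClosed hBc isClosed_Iic

/-! ### Zero sets of `H` and of the dissipation. -/

theorem deriv_V_eq_zero (hP : P.L < P.lam) (hV : AdmissiblePotential P) {s : ℝ} (hs : P.lam ≤ s) :
    deriv P.V s = 0 := by
  -- V ≥ 0 = V s near s, so s = lam needs no separate case.
  refine IsLocalMin.deriv_eq_zero ?_
  filter_upwards [Ioi_mem_nhds (hP.trans_le hs)] with y hy
  rw [hV.eq_zero s hs]
  exact hV.nonneg y hy

theorem lam_le_of_V_eq_zero (hV : AdmissiblePotential P) {s : ℝ} (hs : P.L < s) (h : P.V s = 0) :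
    P.lam ≤ s := by
  by_contra! hlt
  have hanti : StrictAntiOn P.V (Icc s P.lam) := by
    refine strictAntiOn_of_deriv_neg (convex_Icc _ _)
      (hV.contDiffOn.continuousOn.mono fun y hy => hs.trans_le hy.1) fun y hy => ?_
    rw [interior_Icc] at hy
    exact hV.deriv_neg y ⟨hs.trans hy.1, hy.2⟩
  have := hanti (left_mem_Icc.2 hlt.le) (right_mem_Icc.2 hlt.le) hlt
  rw [hV.eq_zero _ le_rfl, h] at this
  exact lt_irrefl _ this

theorem mul_b_nonneg (hb : AdmissibleB P) (y : ℝ) : 0 ≤ y * P.b y := by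
  rcases eq_or_ne y 0 with rfl | hy
  · simp
  · exact (hb.mul_pos y hy).le

theorem dissipation_nonneg (hμ : 0 < P.μ) (hb : AdmissibleB P) {x : State n}
    (hx : x ∈ Omega P n) : 0 ≤ dissipation P x :=
  add_nonneg (mul_nonneg (by positivity) (Finset.sum_nonneg fun i _ => H_term_nonneg hx i))
    (Finset.sum_nonneg fun _ _ => mul_b_nonneg hb _)

theorem speed_eq_f_of_sum_eq_zero {x : State n} (hx : x ∈ Omega P n)
    (h : ∑ i, (speed x i - f P x i) ^ 2 / (speed x i * (P.vmax - speed x i)) = 0) (i : Fin n) :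
    speed x i = f P x i := by
  have := (Finset.sum_eq_zero_iff_of_nonneg fun i _ => H_term_nonneg hx i).1 h i (Finset.mem_univ i)
  rw [div_eq_zero_iff, or_iff_left (speed_mul_pos hx i).ne', sq_eq_zero_iff, sub_eq_zero] at this
  exact this

theorem f_eq_vstar (hP : P.L < P.lam) (hV : AdmissiblePotential P) (hb : AdmissibleB P)
    {x : State n} (hx : ∀ i, P.lam ≤ spacing P x i) (i : Fin n) : f P x i = P.vstar := by
  simp [f, deriv_V_eq_zero hP hV (hx _), hb.map_zero]

theorem mem_E_of_H_eq_zero (hP : AdmissibleConstants P n) (hV : AdmissiblePotential P)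
    (hb : AdmissibleB P) {x : State n} (hx : x ∈ Omega P n) (h : H P x = 0) : x ∈ E P n := by
  have hs : ∀ i, P.lam ≤ spacing P x i := fun i =>
    lam_le_of_V_eq_zero hV (hx.1 i)
      (le_antisymm ((V_spacing_le_H hV hx i).trans h.le) (hV.nonneg _ (hx.1 i)))
  refine ⟨hs, fun i => ?_⟩
  rw [← f_eq_vstar hP.L_lt_lam hV hb hs i]
  refine speed_eq_f_of_sum_eq_zero hx ?_ i
  have hM : 0 < P.vmax := hP.vstar_pos.trans hP.vstar_lt
  have hz : ∑ i, P.V (spacing P x i) = 0 := Finset.sum_eq_zero fun i _ => hV.eq_zero _ (hs i)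
  rw [H, hz, add_zero] at h
  exact (mul_eq_zero.1 h).resolve_left (by positivity)

theorem mem_Omega_of_mem_E (hP : AdmissibleConstants P n) {x : State n} (hx : x ∈ E P n) :
    x ∈ Omega P n :=
  ⟨fun i => hP.L_lt_lam.trans_le (hx.1 i), fun i => by
    rw [hx.2 i]; exact ⟨hP.vstar_pos, hP.vstar_lt⟩⟩

theorem H_eq_zero_of_mem_E (hP : AdmissibleConstants P n) (hV : AdmissiblePotential P)
    (hb : AdmissibleB P) {x : State n} (hx : x ∈ E P n) : H P x = 0 := by
  simp [H, hx.2, f_eq_vstar hP.L_lt_lam hV hb hx.1, hV.eq_zero _ (hx.1 _)]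

theorem dissipation_eq_zero_of_mem_E (hP : AdmissibleConstants P n) (hV : AdmissiblePotential P)
    (hb : AdmissibleB P) {x : State n} (hx : x ∈ E P n) : dissipation P x = 0 := by
  simp [dissipation, forceGap, hx.2, f_eq_vstar hP.L_lt_lam hV hb hx.1,
    deriv_V_eq_zero hP.L_lt_lam hV (hx.1 _)]

theorem eq_apply_zero_of_add_one_eq (hn : 2 ≤ n) {g : Fin n → ℝ} (h : ∀ i, g (i + 1) = g i)
    (i : Fin n) : g i = g 0 := by
  obtain ⟨k, hk⟩ := i
  induction k with
  | zero => rfl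
  | succ k ih =>
    have hk' : k < n := by omega
    rw [← ih hk', ← h ⟨k, hk'⟩]
    congr 1
    ext
    simp only [Fin.val_add, Fin.val_one', Nat.mod_eq_of_lt (show 1 < n by omega),
      Nat.mod_eq_of_lt hk]

/-- Vanishing gaps make V' constant around the ring. V' is negative below lam and zero from lam on,
so the spacings are all below lam or none is; the first is excluded since they sum to R ≥ n lam. -/
theorem mem_E_of_dissipation_eq_zero (hP : AdmissibleConstants P n) (hV : AdmissiblePotential P)
    (hb : AdmissibleB P) (hR : n * P.lam ≤ P.R) {x : State n} (hx : x ∈ Omega P n)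
    (h : dissipation P x = 0) : x ∈ E P n := by
  have hM : 0 < P.vmax := hP.vstar_pos.trans hP.vstar_lt
  have hμ := hP.μ_pos
  have hq : 0 ≤ ∑ i, (speed x i - f P x i) ^ 2 / (speed x i * (P.vmax - speed x i)) :=
    Finset.sum_nonneg fun i _ => H_term_nonneg hx i
  have hg : 0 ≤ ∑ i, forceGap P x i * P.b (forceGap P x i) :=
    Finset.sum_nonneg fun _ _ => mul_b_nonneg hb _
  obtain ⟨h1, h2⟩ := (add_eq_zero_iff_of_nonneg (mul_nonneg (by positivity) hq) hg).1 h
  have hq0 := (mul_eq_zero.1 h1).resolve_left (by positivity)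
  have hgap : ∀ i, forceGap P x i = 0 := fun i => by
    by_contra hne
    have := (Finset.sum_eq_zero_iff_of_nonneg fun i _ => mul_b_nonneg hb _).1 h2 i
      (Finset.mem_univ i)
    exact (hb.mul_pos _ hne).ne' this
  have hconst : ∀ i, deriv P.V (spacing P x i) = deriv P.V (spacing P x 0) :=
    eq_apply_zero_of_add_one_eq hP.two_le (g := fun i => deriv P.V (spacing P x i))
      fun i => sub_eq_zero.1 (hgap i)
  have hs : ∀ i, P.lam ≤ spacing P x i := by
    by_contra! hlt
    obtain ⟨i, hi⟩ := hlt
    have hneg := hV.deriv_neg _ ⟨hx.1 i, hi⟩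
    have hall : ∀ j, spacing P x j < P.lam := fun j => by
      by_contra! hj
      have := deriv_V_eq_zero hP.L_lt_lam hV hj
      rw [hconst j, ← hconst i] at this
      exact hneg.ne this
    have hsum : ∑ i, spacing P x i < ∑ _i : Fin n, P.lam :=
      Finset.sum_lt_sum_of_nonempty ⟨0, Finset.mem_univ _⟩ fun j _ => hall j
    rw [sum_spacing] at hsum
    simp only [Finset.sum_const, Finset.card_univ, Fintype.card_fin, nsmul_eq_mul] at hsum
    linarith
  exact ⟨hs, fun i => (speed_eq_f_of_sum_eq_zero hx hq0 i).trans
    (f_eq_vstar hP.L_lt_lam hV hb hs i)⟩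

theorem E_nonempty (hR : n * P.lam ≤ P.R) : (E P n).Nonempty := by
  have hn : (0 : ℝ) < n := Nat.cast_pos.2 (NeZero.pos n)
  have hc := sum_eq_zero_add_sum_ne (fun _ : Fin n => P.R / n)
  simp only [Finset.sum_const _, Finset.card_univ, Fintype.card_fin, nsmul_eq_mul,
    mul_div_cancel₀ _ hn.ne'] at hc
  -- The equally spaced configuration at the desired speed.
  refine ⟨WithLp.toLp 2 (Sum.elim (fun _ => P.R / n) fun _ => P.vstar), fun i => ?_, fun i => rfl⟩
  have : P.lam ≤ P.R / n := by rw [le_div_iff₀ hn]; linarith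
  refine this.trans_eq ?_
  by_cases hi : i = 0
  · simp only [spacing, hi, dif_pos, Sum.elim_inl, Finset.sum_const, Finset.card_univ,
      nsmul_eq_mul]
    linarith
  · simp [spacing, hi]

/-! ### Comparison functions for the closed loop. -/

theorem exists_pos_le_of_isCompact_sublevel (hL : 0 < P.L) (hV : AdmissiblePotential P)
    (hb : AdmissibleB P) {φ : State n → ℝ} (hφ : ContinuousOn φ (Omega P n))
    (hpos : ∀ x ∈ Omega P n, 0 < φ x) (c : ℝ) (hoff : ∀ x ∈ Omega P n, c < H P x → 1 ≤ φ x) :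
    ∃ m, 0 < m ∧ ∀ x ∈ Omega P n, m ≤ φ x :=
  exists_pos_le_of_isCompact (isCompact_sublevel hL hV hb c) (fun _ hx => hx.1) hφ hpos one_pos
    fun x hx hxc => hoff x hx (not_le.1 fun h => hxc ⟨hx, h⟩)

theorem exists_classKInf_infDist_le_H (hP : AdmissibleConstants P n) (hV : AdmissiblePotential P)
    (hb : AdmissibleB P) (hR : n * P.lam ≤ P.R) :
    ∃ a, ClassKInf a ∧ ∀ x ∈ Omega P n, a (Metric.infDist x (E P n)) ≤ H P x := by
  obtain ⟨e, he⟩ := E_nonempty hR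
  have heΩ := mem_Omega_of_mem_E hP he
  obtain ⟨D, hD⟩ := Metric.isBounded_iff.1 (isBounded_Omega (n := n) hP.L_pos)
  have hHc := (contDiffOn_H (n := n) hV hb).continuousOn
  have hpos : ∀ r, 0 < r → ∃ m, 0 < m ∧
      ∀ x ∈ Omega P n, m ≤ H P x + max (r - Metric.infDist x (E P n)) 0 := fun r hr => by
    have hdc : Continuous fun x => max (r - Metric.infDist x (E P n)) 0 :=
      (continuous_const.sub (Metric.continuous_infDist_pt _)).max continuous_const
    refine exists_pos_le_of_isCompact_sublevel hP.L_pos hV hb (hHc.add hdc.continuousOn)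
      (fun x hx => ?_) 1 fun x _ hx1 => hx1.le.trans (le_add_of_nonneg_right (le_max_right _ _))
    rcases (H_nonneg hV hx).eq_or_lt with h | h
    · have hxE := mem_E_of_H_eq_zero hP hV hb hx h.symm
      rw [← h, zero_add, Metric.infDist_zero_of_mem hxE, sub_zero]
      exact lt_max_of_lt_left hr
    · exact add_pos_of_pos_of_nonneg h (le_max_right _ _)
  obtain ⟨a, ha, ha'⟩ := exists_classKInf (U := Omega P n) (H := H P)
    (d := fun x => Metric.infDist x (E P n)) (D := D) (fun x hx => H_nonneg hV hx)
    (fun x hx => (Metric.infDist_le_dist_of_mem he).trans (hD hx heΩ)) hpos ⟨e, heΩ⟩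
  exact ⟨a, ha, fun x hx => ha' x hx Metric.infDist_nonneg⟩

theorem exists_posDef_le_dissipation (hP : AdmissibleConstants P n) (hV : AdmissiblePotential P)
    (hb : AdmissibleB P) (hR : n * P.lam ≤ P.R) :
    ∃ ρ : ℝ → ℝ, Continuous ρ ∧ (∀ h, 0 ≤ ρ h) ∧ (∀ h, 0 < h → 0 < ρ h) ∧
      (∀ h, 0 < h → ρ h ≤ h) ∧ ∀ x ∈ Omega P n, ρ (H P x) ≤ dissipation P x := by
  obtain ⟨e, he⟩ := E_nonempty hR
  have hW : ∀ x ∈ Omega P n, 0 ≤ dissipation P x := fun x hx => dissipation_nonneg hP.μ_pos hb hx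
  refine exists_posDef_le hW (fun h hh => ?_) (mem_Omega_of_mem_E hP he)
    (H_eq_zero_of_mem_E hP hV hb he) (dissipation_eq_zero_of_mem_E hP hV hb he)
  -- Where H > h + 1 the penalty |h - H| exceeds 1. Where the dissipation vanishes, H = 0 and the
  -- penalty equals h > 0.
  refine exists_pos_le_of_isCompact_sublevel hP.L_pos hV hb ((continuousOn_dissipation hV hb).add
    (continuousOn_const.sub (contDiffOn_H hV hb).continuousOn).abs) (fun x hx => ?_) (h + 1)
    fun x hx hx1 => ?_
  · rcases (hW x hx).eq_or_lt with h0 | h0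
    · rw [H_eq_zero_of_mem_E hP hV hb (mem_E_of_dissipation_eq_zero hP hV hb hR hx h0.symm),
        sub_zero, abs_of_pos hh]
      linarith
    · exact add_pos_of_pos_of_nonneg h0 (abs_nonneg _)
  · linarith [hW x hx, neg_le_abs (h - H P x)]

end RingRoad

end

/-! ### The stability theorem. -/

theorem theorem2 (n : ℕ) [NeZero n] (P : RingRoad.Params)
    (hP : RingRoad.AdmissibleConstants P n)
    (hV : RingRoad.AdmissiblePotential P)
    (hb : RingRoad.AdmissibleB P)
    (hR : n * P.lam ≤ P.R) :
    ∃ (σ : ℝ → ℝ → ℝ) (a : ℝ → ℝ), RingRoad.ClassKL σ ∧ RingRoad.ClassKInf a ∧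
      -- every initial condition in `Omega` is the starting point of a solution on `[0, ∞)`
      (∀ x₀ ∈ RingRoad.Omega P n,
        ∃ x : ℝ → RingRoad.State n, RingRoad.IsSolution P ⊤ x ∧ x 0 = x₀) ∧
      -- every solution on some `[0, T)` continues to all of `[0, ∞)`, staying in `Omega`, and
      -- satisfies the estimate as long as it is defined
      (∀ (T : EReal) (x : ℝ → RingRoad.State n), RingRoad.IsSolution P T x →
        (∃ y : ℝ → RingRoad.State n, RingRoad.IsSolution P ⊤ y ∧
          ∀ t : ℝ, 0 ≤ t → (t : EReal) < T → y t = x t) ∧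
        ∀ t : ℝ, 0 ≤ t → (t : EReal) < T →
          a (Metric.infDist (x t) (RingRoad.E P n)) ≤ RingRoad.H P (x t) ∧
          RingRoad.H P (x t) ≤ σ (RingRoad.H P (x 0)) t) := by
  obtain ⟨a, ha, haH⟩ := RingRoad.exists_classKInf_infDist_le_H hP hV hb hR
  obtain ⟨ρ, hρc, hρ0, hρpos, hρle, hρ⟩ := RingRoad.exists_posDef_le_dissipation hP hV hb hR
  obtain ⟨σ, hσ, hσH⟩ := RingRoad.exists_classKL hρc (fun h _ => hρ0 h) hρpos hρle
  have hglob := fun (x₀ : RingRoad.State n) (hx₀ : x₀ ∈ RingRoad.Omega P n) =>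
    exists_global_of_lyapunov RingRoad.isOpen_Omega (RingRoad.contDiffOn_closedLoop hV hb)
      (fun x hx => RingRoad.dissipation_nonneg hP.μ_pos hb hx)
      (fun x hx => RingRoad.fderiv_H_closedLoop hV hb hx)
      (RingRoad.isCompact_sublevel hP.L_pos hV hb) hx₀
  have hsol : ∀ x : ℝ → RingRoad.State n, (∀ t, 0 ≤ t → x t ∈ RingRoad.Omega P n ∧
      HasDerivAt x (RingRoad.closedLoop P (x t)) t) → RingRoad.IsSolution P ⊤ x := fun x hx =>
    ⟨EReal.coe_lt_top 0, fun t ht _ => (hx t ht).1, fun t ht _ => (hx t ht).2.hasDerivWithinAt⟩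
  refine ⟨σ, a, hσ, ha, fun x₀ hx₀ => ?_, fun T x hx => ⟨?_, fun t ht htT => ⟨?_, ?_⟩⟩⟩
  · obtain ⟨x, h0, hx, -⟩ := hglob x₀ hx₀
    exact ⟨x, hsol x hx, h0⟩
  -- The global solution from `x 0` is the required extension, by uniqueness on each [0, t] with t <
  -- T.
  · obtain ⟨y, -, hy, huniq⟩ := hglob (x 0) (hx.mem 0 le_rfl hx.pos)
    refine ⟨y, hsol y hy, fun t ht htT => ?_⟩
    have hlt : ∀ s ∈ Set.Icc 0 t, (s : EReal) < T := fun s hs =>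
      (EReal.coe_le_coe_iff.2 hs.2).trans_lt htT
    exact (huniq t x ht (fun s hs => hx.mem s hs.1 (hlt s hs))
      (fun s hs => hx.hasDeriv s hs.1 (hlt s hs)) rfl).symm
  · exact haH _ (hx.mem t ht htT)
  · have hlt : ∀ s ∈ Set.Icc 0 t, (s : EReal) < T := fun s hs =>
      (EReal.coe_le_coe_iff.2 hs.2).trans_lt htT
    have hmem := fun s hs => hx.mem s (Set.mem_Icc.1 hs).1 (hlt s hs)
    refine hσH (fun s => RingRoad.H P (x s)) (fun s => - RingRoad.dissipation P (x s)) t ht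
      (fun s hs => RingRoad.H_nonneg hV (hmem s hs)) (fun s hs => ?_)
      fun s hs => neg_le_neg (hρ _ (hmem s hs))
    obtain ⟨H', h1, h2⟩ := RingRoad.fderiv_H_closedLoop hV hb (hmem s hs)
    rw [← h2]
    exact h1.comp_hasDerivWithinAt s ((hx.hasDeriv s hs.1 (hlt s hs)).mono
      (Set.Icc_subset_Ici_self : Set.Icc 0 t ⊆ Set.Ici 0))
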